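/- For a group $G$ let $\psi\colon G\to G^\psi$, $g\mapsto g^\psi$, be an isomorphism onto a disjoint copy of $G$, and let $$X(G)=\langle G, G^\psi \mid [g,g^\psi],\ g\in G\rangle$$ be the Sidki double of $G$, that is, the quotient of the free product $G*G^\psi$ by the normal closure of the commutators $[g,g^\psi]=g^{-1}(g^\psi)^{-1}g\,g^\psi$, $g\in G$. Let $\rho\colon X(G)\to G\times G\times G$ be the homomorphism defined on generators by $\rho(g)=(g,g,1)$ and $\rho(g^\psi)=(1,g,g)$, and let $W(G)=\ker\rho$. For a ring $R$, a group $H$, a matrix $A=(a_{ij})\in M_n(RH)$ with $a_{ij}=\sum_{h\in H}a_{ij}(h)\,h$, and $x\in H$, let $$r_A(x)=\sum_{y\in[x],\ 1\le i\le n}a_{ii}(y)$$ be the Hattori–Stallings trace, where $[x]$ is the conjugacy class of $x$ in $H$. Let $G$ be a finitely generated group, let $R=\mathbb Z$ or $R=\mathbb C$, and let $A\in M_n(R\,X(G))$ be an idempotent matrix. If $y\in W(G)$ is an element of infinite order, then $r_A(y)=0$. -/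

import Mathlib

/-- The relators `[g, g^ψ] = g⁻¹ (g^ψ)⁻¹ g g^ψ`, `g ∈ G`, in the free product `G * G^ψ`; the copy
`G^ψ` is the second free factor, so that `g` is `inl g` and `g^ψ` is `inr g`. -/
def sidkiRelators (G : Type*) [Group G] : Set (Monoid.Coprod G G) :=
  Set.range fun g : G =>
    (Monoid.Coprod.inl g)⁻¹ * (Monoid.Coprod.inr g)⁻¹ * Monoid.Coprod.inl g * Monoid.Coprod.inr g

/-- The Sidki double `X(G) = ⟨G, G^ψ | [g, g^ψ], g ∈ G⟩`. -/
abbrev SidkiDouble (G : Type*) [Group G] : Type _ :=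
  Monoid.Coprod G G ⧸ Subgroup.normalClosure (sidkiRelators G)

namespace SidkiDouble

/-- The element `g` of `X(G)`, for `g ∈ G`. -/
def left (G : Type*) [Group G] : G →* SidkiDouble G :=
  (QuotientGroup.mk' (Subgroup.normalClosure (sidkiRelators G))).comp Monoid.Coprod.inl

/-- The element `g^ψ` of `X(G)`, for `g ∈ G`. -/
def right (G : Type*) [Group G] : G →* SidkiDouble G :=
  (QuotientGroup.mk' (Subgroup.normalClosure (sidkiRelators G))).comp Monoid.Coprod.inr

/-- The homomorphism `G * G^ψ → G × G × G` with `g ↦ (g, g, 1)` and `g^ψ ↦ (1, g, g)`. -/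
def preRho (G : Type*) [Group G] : Monoid.Coprod G G →* G × G × G :=
  Monoid.Coprod.lift
    ((MonoidHom.id G).prod ((MonoidHom.id G).prod 1))
    ((1 : G →* G).prod ((MonoidHom.id G).prod (MonoidHom.id G)))

theorem normalClosure_le_ker_preRho (G : Type*) [Group G] :
    Subgroup.normalClosure (sidkiRelators G) ≤ (preRho G).ker := by
  apply Subgroup.normalClosure_le_normal
  rintro _ ⟨g, rfl⟩
  simp [MonoidHom.mem_ker, preRho]

/-- The homomorphism `ρ : X(G) → G × G × G` with `ρ(g) = (g, g, 1)` and `ρ(g^ψ) = (1, g, g)`. -/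
def rho (G : Type*) [Group G] : SidkiDouble G →* G × G × G :=
  QuotientGroup.lift _ (preRho G) (normalClosure_le_ker_preRho G)

theorem rho_left {G : Type*} [Group G] (g : G) : rho G (left G g) = (g, g, 1) := by
  simp [rho, left, preRho]

theorem rho_right {G : Type*} [Group G] (g : G) : rho G (right G g) = (1, g, g) := by
  simp [rho, right, preRho]

/-- The subgroup `W(G) = ker ρ` of `X(G)`. -/
def W (G : Type*) [Group G] : Subgroup (SidkiDouble G) := (rho G).ker

end SidkiDouble

open Classical in
/-- The Hattori–Stallings trace `r_A(x) = ∑_{y ∈ [x], 1 ≤ i ≤ n} a_{ii}(y)` of a square matrix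
`A = (a_{ij})` over the group ring `R H`, where `[x]` is the conjugacy class of `x` in `H`. The sum
is finite: for each `i` it runs over the conjugates of `x` in the support of `a_{ii}`. -/
noncomputable def hattoriStallingsTrace {R H : Type*} [Semiring R] [Group H] {n : ℕ}
    (A : Matrix (Fin n) (Fin n) (MonoidAlgebra R H)) (x : H) : R :=
  ∑ i : Fin n, ∑ y ∈ (A i i).coeff.support with IsConj x y, (A i i).coeff y

/-! Suppose `r_A(y) ≠ 0` over `ℂ`. Two incompatible facts about prime powers of `y` follow.

The coefficients of `A` and the inverse of `r_A(y)` lie in a finitely generated subring `S` of `ℂ`.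
For almost all primes `p`, `S` has a quotient field of characteristic `p`, over which `A` stays
idempotent with nonzero trace at `y`. There the trace of `A ^ p = A` is the Frobenius twist of the
trace of `A` (`traceClassSum_pow_prime`), so every class in its finite support is a `p`-th power of
another one. Hence `y` is conjugate to `y ^ p ^ k` for some `k ≠ 0`
(`exists_isConj_pow_of_hattoriStallingsTrace_ne_zero`).

On the other hand `W(G)` is abelian and centralized by the commutator subgroup of `X(G)`, so the
conjugates of `y` generate a cyclic module `ℤ[X(G)^ab] / I`, where `I` is the annihilator of `y`.
This quotient is a finitely generated commutative ring, of characteristic zero because `y` has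
infinite order. A conjugation taking `y` to `y ^ p ^ k` makes `p ^ k` a unit in it, but only
finitely many primes are units in such a ring (`exists_forall_not_dvd_not_isUnit`,
`exists_forall_not_isConj_pow`).

The case of `ℤ` follows by extending scalars to `ℂ`. -/

/-! ### Additivity of `p`-th powers modulo commutators -/

/-- If a family of finitely many terms killed by `p` is invariant under a permutation of order
dividing `p`, then its sum is the sum over the fixed points. -/
theorem sum_eq_sum_fixed_of_pow_eq_one {α V : Type*} [Fintype α] [DecidableEq α] [AddCommGroup V]
    {p : ℕ} [hp : Fact p.Prime] (hV : ∀ v : V, p • v = 0) (σ : Equiv.Perm α) (hσ : σ ^ p = 1)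
    (f : α → V) (hf : ∀ a, f (σ a) = f a) :
    ∑ a, f a = ∑ a with σ a = a, f a := by
  classical
  -- Each fibre of `f` is `σ`-stable, and its nontrivial `σ`-orbits have length `p`.
  have key : ∀ v : V, ((Finset.univ.filter fun a => f a = v).card : ℕ) ≡
      ((Finset.univ.filter fun a => σ a = a ∧ f a = v).card : ℕ) [MOD p] := by
    intro v
    let τ : Equiv.Perm {a // f a = v} := σ.subtypePerm (fun a => by rw [hf])
    have hτ : τ ^ (p ^ 1) = 1 := by
      rw [pow_one]
      ext a
      simp [τ, Equiv.Perm.subtypePerm_pow, hσ]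
    have h := Equiv.Perm.card_compl_support_modEq hτ
    have e1 : Fintype.card {a // f a = v} = (Finset.univ.filter fun a => f a = v).card :=
      Fintype.card_subtype _
    have e2 : τ.supportᶜ.card = (Finset.univ.filter fun a => σ a = a ∧ f a = v).card := by
      refine Finset.card_bij (fun a _ => a.1) (fun a ha => ?_) (fun a _ b _ h => Subtype.ext h)
        (fun a ha => ?_)
      · have : τ a = a := by simpa using ha
        exact Finset.mem_filter.2 ⟨Finset.mem_univ _, congrArg Subtype.val this, a.2⟩
      · obtain ⟨h1, h2⟩ := (Finset.mem_filter.1 ha).2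
        exact ⟨⟨a, h2⟩, by simpa using Subtype.ext h1, rfl⟩
    rw [← e1, ← e2]
    exact h.symm
  have hmod : ∀ (v : V) (m n : ℕ), m ≡ n [MOD p] → m • v = n • v := by
    intro v m n h
    have aux : ∀ m : ℕ, m • v = (m % p) • v := fun m => by
      conv_lhs => rw [← Nat.mod_add_div m p, add_nsmul, mul_nsmul', hV, add_zero]
    rw [aux m, aux n, h]
  have h1 : ∀ s : Finset α, ∑ a ∈ s, f a =
      ∑ v ∈ Finset.univ.image f, (s.filter fun a => f a = v).card • v := by
    intro s
    rw [← Finset.sum_fiberwise_of_maps_to (t := Finset.univ.image f) (g := f)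
      (fun a _ => Finset.mem_image_of_mem _ (Finset.mem_univ a))]
    refine Finset.sum_congr rfl fun v _ => ?_
    rw [← Finset.sum_const]
    exact Finset.sum_congr rfl fun a ha => (Finset.mem_filter.mp ha).2
  rw [h1, h1]
  refine Finset.sum_congr rfl fun v _ => ?_
  rw [Finset.filter_filter]
  exact hmod v _ _ (key v)

/-- Rotation of words of length `m + 1`. -/
def rotateWord (m : ℕ) (ι : Type*) : Equiv.Perm (Fin (m + 1) → ι) :=
  (finRotate (m + 1)).symm.arrowCongr (Equiv.refl ι)

theorem rotateWord_apply {m : ℕ} {ι : Type*} (f : Fin (m + 1) → ι) (i : Fin (m + 1)) :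
    rotateWord m ι f i = f (i + 1) := by
  simp [rotateWord]

open Fin.CommRing in
theorem rotateWord_pow_apply {m : ℕ} {ι : Type*} (k : ℕ) (f : Fin (m + 1) → ι) (i : Fin (m + 1)) :
    (rotateWord m ι ^ k) f i = f (i + (k : Fin (m + 1))) := by
  induction k generalizing i with
  | zero => simp
  | succ k ih =>
    rw [pow_succ', Equiv.Perm.mul_apply, rotateWord_apply, ih]
    push_cast
    congr 1
    ring

open Fin.CommRing in
theorem rotateWord_pow_length (m : ℕ) (ι : Type*) : rotateWord m ι ^ (m + 1) = 1 := by
  ext f i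
  rw [rotateWord_pow_apply]
  simp

open Fin.CommRing in
theorem rotateWord_eq_self_iff {m : ℕ} {ι : Type*} (f : Fin (m + 1) → ι) :
    rotateWord m ι f = f ↔ ∃ c, f = fun _ => c := by
  constructor
  · intro h
    refine ⟨f 0, funext fun i => ?_⟩
    have hk : ∀ k : ℕ, (rotateWord m ι ^ k) f = f := fun k => by
      induction k with
      | zero => rfl
      | succ k ih => rw [pow_succ', Equiv.Perm.mul_apply, ih, h]
    have := congrFun (hk i) 0
    rw [rotateWord_pow_apply] at this
    simpa using this
  · rintro ⟨c, rfl⟩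
    ext i
    rw [rotateWord_apply]

/-- Rotation moves the first letter of the word to the end, which is one application of `hT`. -/
theorem trace_prod_rotateWord {E V ι : Type*} [Ring E] [AddCommGroup V] (T : E →+ V)
    (hT : ∀ a b, T (a * b) = T (b * a)) {m : ℕ} (x : ι → E) (f : Fin (m + 1) → ι) :
    T (List.ofFn fun i => x (rotateWord m ι f i)).prod = T (List.ofFn fun i => x (f i)).prod := by
  rw [List.ofFn_succ' , List.ofFn_succ (f := fun i => x (f i)), List.concat_eq_append,
    List.prod_append, List.prod_cons, hT]
  simp [rotateWord_apply]

/-- In characteristic `p`, the `p`-th power map is additive modulo commutators. -/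
theorem trace_add_pow_prime {E V : Type*} [Ring E] [AddCommGroup V] {p : ℕ} [hp : Fact p.Prime]
    (hV : ∀ v : V, p • v = 0) (T : E →+ V) (hT : ∀ a b, T (a * b) = T (b * a)) (a b : E) :
    T ((a + b) ^ p) = T (a ^ p) + T (b ^ p) := by
  classical
  obtain ⟨m, rfl⟩ : ∃ m, p = m + 1 := ⟨p - 1, (Nat.succ_pred_eq_of_pos hp.out.pos).symm⟩
  let x : Fin 2 → E := ![a, b]
  have expand : (a + b) ^ (m + 1) =
      ∑ f : Fin (m + 1) → Fin 2, (List.ofFn fun i => x (f i)).prod := by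
    have h := (MultilinearMap.mkPiAlgebraFin ℤ (m + 1) E).map_sum (fun _ j => x j)
    simp only [MultilinearMap.mkPiAlgebraFin_apply] at h
    rw [← h, List.ofFn_const, List.prod_replicate]
    simp [x, Fin.sum_univ_two]
  -- Only the constant words survive; they give `a ^ p` and `b ^ p`.
  rw [expand, map_sum, sum_eq_sum_fixed_of_pow_eq_one hV (rotateWord m (Fin 2))
    (rotateWord_pow_length m _) _ (trace_prod_rotateWord T hT x)]
  have himg : (Finset.univ.filter fun f => rotateWord m (Fin 2) f = f) =
      Finset.univ.image fun c : Fin 2 => (fun _ : Fin (m + 1) => c) := by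
    ext f
    rw [Finset.mem_filter, rotateWord_eq_self_iff]
    simp only [Finset.mem_univ, true_and, Finset.mem_image, eq_comm]
  rw [himg, Finset.sum_image fun c _ d _ h => congrFun h 0]
  simp only [List.ofFn_const, List.prod_replicate, Fin.sum_univ_two]
  rfl

/-! ### The trace as a function on conjugacy classes -/

namespace ConjClasses

/-- The `n`-th power map on conjugacy classes. -/
def powMap {H : Type*} [Group H] (n : ℕ) : ConjClasses H → ConjClasses H :=
  Quotient.map (· ^ n) fun _ _ h => IsConj.pow n h

theorem powMap_mk {H : Type*} [Group H] (n : ℕ) (x : H) :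
    powMap n (ConjClasses.mk x) = ConjClasses.mk (x ^ n) := rfl

theorem powMap_powMap {H : Type*} [Group H] (m n : ℕ) (c : ConjClasses H) :
    powMap m (powMap n c) = powMap (n * m) c := by
  induction c using Quotient.inductionOn with
  | h x => exact congrArg ConjClasses.mk (pow_mul x n m).symm

end ConjClasses

/-- The projection of a group ring onto functions on the conjugacy classes. -/
noncomputable def classSum (R H : Type*) [Semiring R] [Group H] :
    MonoidAlgebra R H →+ (ConjClasses H →₀ R) :=
  (Finsupp.mapDomain.addMonoidHom ConjClasses.mk).comp
    (MonoidAlgebra.coeffAddEquiv (R := R) (M := H)).toAddMonoidHom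

theorem classSum_single {R H : Type*} [Semiring R] [Group H] (h : H) (r : R) :
    classSum R H (MonoidAlgebra.single h r) = Finsupp.single (ConjClasses.mk h) r := by
  simp [classSum]

/-- By biadditivity this is the fact that `g * h` and `h * g` are conjugate. -/
theorem classSum_mul_comm {R H : Type*} [CommRing R] [Group H] (a b : MonoidAlgebra R H) :
    classSum R H (a * b) = classSum R H (b * a) := by
  have : ((AddMonoidHom.mul (R := MonoidAlgebra R H)).compr₂ (classSum R H)) =
      ((AddMonoidHom.mul (R := MonoidAlgebra R H)).flip.compr₂ (classSum R H)) := by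
    refine MonoidAlgebra.addMonoidHom_ext fun g r => MonoidAlgebra.addMonoidHom_ext fun h s => ?_
    simp only [AddMonoidHom.compr₂_apply, AddMonoidHom.mul_apply, AddMonoidHom.flip_apply,
      MonoidAlgebra.single_mul_single, classSum_single]
    have : ConjClasses.mk (g * h) = ConjClasses.mk (h * g) :=
      ConjClasses.mk_eq_mk_iff_isConj.2 (isConj_iff.2 ⟨h, by group⟩)
    rw [this, mul_comm r s]
  exact DFunLike.congr_fun (DFunLike.congr_fun this a) b

/-- The Hattori–Stallings trace, as a finitely supported function on conjugacy classes. -/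
noncomputable def traceClassSum (R H : Type*) [Semiring R] [Group H] (n : ℕ) :
    Matrix (Fin n) (Fin n) (MonoidAlgebra R H) →+ (ConjClasses H →₀ R) :=
  (classSum R H).comp (Matrix.traceAddMonoidHom (Fin n) (MonoidAlgebra R H))

theorem traceClassSum_apply {R H : Type*} [Semiring R] [Group H] {n : ℕ}
    (A : Matrix (Fin n) (Fin n) (MonoidAlgebra R H)) :
    traceClassSum R H n A = ∑ i, classSum R H (A i i) := by
  simp [traceClassSum, Matrix.trace]

theorem hattoriStallingsTrace_eq {R H : Type*} [Semiring R] [Group H] {n : ℕ}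
    (A : Matrix (Fin n) (Fin n) (MonoidAlgebra R H)) (x : H) :
    hattoriStallingsTrace A x = traceClassSum R H n A (ConjClasses.mk x) := by
  classical
  rw [traceClassSum_apply, Finsupp.finsetSum_apply, hattoriStallingsTrace]
  refine Finset.sum_congr rfl fun i _ => ?_
  simp only [classSum, AddMonoidHom.comp_apply]
  change _ = Finsupp.mapDomain ConjClasses.mk (A i i).coeff (ConjClasses.mk x)
  rw [Finsupp.mapDomain, Finsupp.sum_apply, Finsupp.sum, Finset.sum_filter]
  refine Finset.sum_congr (by congr) fun y _ => ?_
  rw [Finsupp.single_apply]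
  refine if_congr ?_ rfl rfl
  rw [ConjClasses.mk_eq_mk_iff_isConj]
  exact ⟨IsConj.symm, IsConj.symm⟩

theorem traceClassSum_mul_comm {R H : Type*} [CommRing R] [Group H] {n : ℕ}
    (A B : Matrix (Fin n) (Fin n) (MonoidAlgebra R H)) :
    traceClassSum R H n (A * B) = traceClassSum R H n (B * A) := by
  simp only [traceClassSum_apply, Matrix.mul_apply, map_sum]
  rw [Finset.sum_comm]
  exact Finset.sum_congr rfl fun i _ => Finset.sum_congr rfl fun j _ => classSum_mul_comm _ _

theorem traceClassSum_single_same {R H : Type*} [Semiring R] [Group H] {n : ℕ} (i : Fin n)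
    (a : MonoidAlgebra R H) : traceClassSum R H n (Matrix.single i i a) = classSum R H a := by
  simp [traceClassSum]

/-- Naturality in the coefficients allows the trace to be moved between `ℤ`, `ℂ`, a subring `S` of
`ℂ` and a residue field of `S`. -/
theorem traceClassSum_map {R R' H : Type*} [Semiring R] [Semiring R'] [Group H] {n : ℕ}
    (f : R →+* R') (A : Matrix (Fin n) (Fin n) (MonoidAlgebra R H)) (c : ConjClasses H) :
    traceClassSum R' H n (A.map (MonoidAlgebra.mapRingHom H f)) c =
      f (traceClassSum R H n A c) := by
  have h : ((Finsupp.mapRange.addMonoidHom f.toAddMonoidHom).comp (classSum R H)) =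
      (classSum R' H).comp (MonoidAlgebra.mapRingHom H f).toAddMonoidHom :=
    MonoidAlgebra.addMonoidHom_ext fun g r => by simp [classSum_single]
  rw [traceClassSum_apply, traceClassSum_apply, Finsupp.finsetSum_apply, Finsupp.finsetSum_apply,
    map_sum]
  refine Finset.sum_congr rfl fun i _ => ?_
  exact (DFunLike.congr_fun (DFunLike.congr_fun h (A i i)) c).symm

/-! ### Traces of idempotents in characteristic `p` -/

/-- The semilinear extension of the `p`-th power map on conjugacy classes. -/
noncomputable def classFrobenius (R H : Type*) [CommRing R] [Group H] (p : ℕ) [ExpChar R p] :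
    (ConjClasses H →₀ R) →+ (ConjClasses H →₀ R) :=
  Finsupp.liftAddHom fun c =>
    (Finsupp.singleAddHom (ConjClasses.powMap p c)).comp (frobenius R p).toAddMonoidHom

theorem classFrobenius_single {R H : Type*} [CommRing R] [Group H] (p : ℕ) [ExpChar R p]
    (c : ConjClasses H) (r : R) :
    classFrobenius R H p (Finsupp.single c r) = Finsupp.single (ConjClasses.powMap p c) (r ^ p) :=
  Finsupp.liftAddHom_apply_single _ _ _

/-- In characteristic `p`, the trace of `A ^ p` is the Frobenius twist of the trace of `A`. -/
theorem traceClassSum_pow_prime {R H : Type*} [CommRing R] [Group H] {n p : ℕ} [hp : Fact p.Prime]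
    [CharP R p] (A : Matrix (Fin n) (Fin n) (MonoidAlgebra R H)) :
    traceClassSum R H n (A ^ p) = classFrobenius R H p (traceClassSum R H n A) := by
  have hV : ∀ v : ConjClasses H →₀ R, p • v = 0 := fun v => by
    ext c
    simp
  let F : Matrix (Fin n) (Fin n) (MonoidAlgebra R H) →+ (ConjClasses H →₀ R) :=
    AddMonoidHom.mk' (fun A => traceClassSum R H n (A ^ p))
      (trace_add_pow_prime hV _ traceClassSum_mul_comm)
  have h : F = (classFrobenius R H p).comp (traceClassSum R H n) := by
    -- Both sides are additive in `A`, so matrices with one monomial entry suffice. Off the diagonal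
    -- such a matrix squares to zero and has trace zero.
    refine Matrix.ext_addMonoidHom fun i j => MonoidAlgebra.addMonoidHom_ext fun g r => ?_
    simp only [F, AddMonoidHom.comp_apply, AddMonoidHom.mk'_apply,
      Matrix.singleAddMonoidHom_apply]
    by_cases hij : i = j
    · subst hij
      have hpow : ∀ k : ℕ, Matrix.single i i (MonoidAlgebra.single g r) ^ (k + 1) =
          Matrix.single i i (MonoidAlgebra.single (g ^ (k + 1)) (r ^ (k + 1))) := fun k => by
        induction k with
        | zero => simp
        | succ k ih =>
          rw [pow_succ, ih, Matrix.single_mul_single_same, MonoidAlgebra.single_mul_single,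
            ← pow_succ, ← pow_succ]
      obtain ⟨m, hm⟩ : ∃ m, p = m + 1 := ⟨p - 1, (Nat.succ_pred_eq_of_pos hp.out.pos).symm⟩
      have hpp := hpow m
      rw [← hm] at hpp
      rw [hpp, traceClassSum_single_same, traceClassSum_single_same, classSum_single,
        classSum_single, classFrobenius_single, ConjClasses.powMap_mk]
    · have h0 : Matrix.single i j (MonoidAlgebra.single g r) ^ p = 0 := by
        refine pow_eq_zero_of_le hp.out.two_le ?_
        rw [pow_two, Matrix.single_mul_single_of_ne _ _ _ _ (Ne.symm hij)]
      rw [h0, map_zero]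
      have h1 : traceClassSum R H n (Matrix.single i j (MonoidAlgebra.single g r)) = 0 := by
        simp [traceClassSum, Matrix.trace_single_eq_of_ne _ _ _ hij]
      rw [h1, map_zero]
  exact DFunLike.congr_fun h A

/-- A class in the support of the trace of an idempotent matrix in characteristic `p` is the
`p`-th power of a class in the support. -/
theorem exists_powMap_eq_of_isIdempotentElem {R H : Type*} [CommRing R] [Group H] {n p : ℕ}
    [hp : Fact p.Prime] [CharP R p] {A : Matrix (Fin n) (Fin n) (MonoidAlgebra R H)}
    (hA : IsIdempotentElem A) {c : ConjClasses H} (hc : c ∈ (traceClassSum R H n A).support) :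
    ∃ d ∈ (traceClassSum R H n A).support, ConjClasses.powMap p d = c := by
  by_contra! hcon
  have h := traceClassSum_pow_prime (p := p) A
  rw [hA.pow_eq hp.out.ne_zero] at h
  refine Finsupp.mem_support_iff.1 hc ?_
  rw [h]
  simp only [classFrobenius, Finsupp.liftAddHom_apply, Finsupp.sum]
  rw [Finsupp.finsetSum_apply]
  refine Finset.sum_eq_zero fun d hd => ?_
  simp [hcon d hd]

/-- Choosing `p`-th roots inside the finite support gives a backward orbit of `c`, which must
repeat. Raising the repetition forward to `c` shows that `c` is periodic under the `p`-th power map.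
-/
theorem exists_powMap_pow_eq_of_isIdempotentElem {R H : Type*} [CommRing R] [Group H] {n p : ℕ}
    [hp : Fact p.Prime] [CharP R p] {A : Matrix (Fin n) (Fin n) (MonoidAlgebra R H)}
    (hA : IsIdempotentElem A) {c : ConjClasses H} (hc : c ∈ (traceClassSum R H n A).support) :
    ∃ k : ℕ, k ≠ 0 ∧ ConjClasses.powMap (p ^ k) c = c := by
  choose! r hr hrp using fun c => exists_powMap_eq_of_isIdempotentElem (p := p) hA (c := c)
  have hmem : ∀ i, r^[i] c ∈ (traceClassSum R H n A).support := fun i => by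
    induction i with
    | zero => exact hc
    | succ i ih => rw [Function.iterate_succ_apply']; exact hr _ ih
  have hpow : ∀ i j, ConjClasses.powMap (p ^ j) (r^[i + j] c) = r^[i] c := fun i j => by
    induction j with
    | zero =>
      simp only [pow_zero, add_zero]
      induction r^[i] c using Quotient.inductionOn with
      | h x => exact congrArg ConjClasses.mk (pow_one x)
    | succ j ih =>
      rw [← add_assoc, Function.iterate_succ_apply', pow_succ', ← ConjClasses.powMap_powMap,
        hrp _ (hmem _), ih]
  obtain ⟨i, j, hij, heq⟩ : ∃ i j, i < j ∧ r^[i] c = r^[j] c := by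
    obtain ⟨i, -, j, -, hne, h⟩ := Set.infinite_univ.exists_ne_map_eq_of_mapsTo
      (f := fun i => r^[i] c) (fun i _ => hmem i) (traceClassSum R H n A).support.finite_toSet
    rcases lt_or_gt_of_ne hne with h' | h'
    exacts [⟨i, j, h', h⟩, ⟨j, i, h', h.symm⟩]
  obtain ⟨k, rfl⟩ := Nat.exists_eq_add_of_lt hij
  refine ⟨k + 1, Nat.succ_ne_zero k, ?_⟩
  have h0 : ConjClasses.powMap (p ^ i) (r^[i] c) = c := by simpa using hpow 0 i
  have h1 : ConjClasses.powMap (p ^ (k + 1)) (r^[i] c) = r^[i] c := by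
    conv_lhs => rw [heq]
    exact hpow i (k + 1)
  calc ConjClasses.powMap (p ^ (k + 1)) c
      = ConjClasses.powMap (p ^ (k + 1)) (ConjClasses.powMap (p ^ i) (r^[i] c)) := by rw [h0]
    _ = ConjClasses.powMap (p ^ i) (ConjClasses.powMap (p ^ (k + 1)) (r^[i] c)) := by
      rw [ConjClasses.powMap_powMap, ConjClasses.powMap_powMap, mul_comm]
    _ = c := by rw [h1, h0]

-- Invertible primes in finitely generated rings

universe u

/-- A finitely generated ring of characteristic zero maps to a number field. -/
theorem exists_ringHom_numberField (S : Type u) [CommRing S] [Algebra ℤ S]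
    [Algebra.FiniteType ℤ S] (hS : ∀ n : ℕ, n ≠ 0 → (n : S) ≠ 0) :
    ∃ (K : Type u) (_ : Field K) (_ : CharZero K) (_ : S →+* K), Module.Finite ℚ K := by
  classical
  -- Inverting all nonzero integers makes every residue field of the localization a `ℚ`-algebra.
  let M : Submonoid S := Submonoid.map (Nat.castRingHom S) (nonZeroDivisors ℕ)
  let Q := Localization M
  have h0 : (0 : S) ∉ M := by
    rintro ⟨n, hn, h⟩
    exact hS n (nonZeroDivisors.ne_zero hn) h
  have : Nontrivial Q := by
    rwa [← not_subsingleton_iff_nontrivial, IsLocalization.subsingleton_iff (S := Q) (M := M)]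
  have hun : ∀ n : ℕ, n ≠ 0 → IsUnit (n : Q) := fun n hn => by
    have := IsLocalization.map_units Q (⟨(n : S), n, mem_nonZeroDivisors_of_ne_zero hn, rfl⟩ : M)
    simpa using this
  obtain ⟨m, hm⟩ := Ideal.exists_maximal Q
  let K := Q ⧸ m
  let _ : Field K := Ideal.Quotient.field m
  let f : S →+* K := (Ideal.Quotient.mk m).comp (algebraMap S Q)
  have hunK : ∀ n : ℕ, n ≠ 0 → (n : K) ≠ 0 := fun n hn => by
    have := (hun n hn).map (Ideal.Quotient.mk m)
    rw [map_natCast] at this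
    exact this.ne_zero
  have : CharZero K := charZero_of_inj_zero fun n hn => by
    by_contra h
    exact hunK n h hn
  obtain ⟨s, hs⟩ := Algebra.FiniteType.out (R := ℤ) (A := S)
  have htop : Algebra.adjoin ℚ (f '' (s : Set S)) = ⊤ := by
    have hf : ∀ x, f x ∈ Algebra.adjoin ℚ (f '' (s : Set S)) := fun x => by
      have hx : x ∈ Algebra.adjoin ℤ (s : Set S) := hs ▸ Algebra.mem_top
      induction hx using Algebra.adjoin_induction with
      | mem x hx => exact Algebra.subset_adjoin ⟨x, hx, rfl⟩
      | algebraMap n =>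
        have : f (algebraMap ℤ S n) = algebraMap ℚ K n := by simp
        rw [this]
        exact Subalgebra.algebraMap_mem _ _
      | add x y _ _ hx hy => rw [map_add]; exact add_mem hx hy
      | mul x y _ _ hx hy => rw [map_mul]; exact mul_mem hx hy
    refine eq_top_iff.2 fun z _ => ?_
    obtain ⟨q, rfl⟩ := Ideal.Quotient.mk_surjective z
    obtain ⟨x, ⟨_, n, hn, rfl⟩, rfl⟩ := IsLocalization.exists_mk'_eq M q
    have hn0 : n ≠ 0 := nonZeroDivisors.ne_zero hn
    have e : Ideal.Quotient.mk m (IsLocalization.mk' Q x (⟨(n : S), n, hn, rfl⟩ : M)) =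
        algebraMap ℚ K (n : ℚ)⁻¹ * f x := by
      rw [map_inv₀, map_natCast, eq_inv_mul_iff_mul_eq₀ (hunK n hn0)]
      have := IsLocalization.mk'_spec' Q x (⟨(n : S), n, hn, rfl⟩ : M)
      have h2 := congrArg (Ideal.Quotient.mk m) this
      rw [map_mul, map_natCast, map_natCast] at h2
      exact h2
    exact e ▸ mul_mem (Subalgebra.algebraMap_mem _ _) (hf x)
  have : Algebra.FiniteType ℚ K := ⟨⟨s.image f, by simpa using htop⟩⟩
  -- Zariski's lemma: a field of finite type over `ℚ` is finite over `ℚ`.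
  have : Module.Finite ℚ K := finite_of_finite_type_of_isJacobsonRing ℚ K
  exact ⟨K, inferInstance, inferInstance, f, this⟩

/-- Only finitely many primes are invertible in a finitely generated ring that maps to a number
field. -/
theorem exists_forall_not_dvd_not_isUnit_of_ringHom {S K : Type*} [CommRing S]
    [Algebra ℤ S] [Algebra.FiniteType ℤ S] [Field K] [CharZero K] [Module.Finite ℚ K] (f : S →+* K) :
    ∃ N : ℕ, N ≠ 0 ∧ ∀ p : ℕ, p.Prime → ¬ p ∣ N → ¬ IsUnit (p : S) := by
  classical
  have hunK : ∀ n : ℕ, n ≠ 0 → (n : K) ≠ 0 := fun n hn => Nat.cast_ne_zero.2 hn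
  obtain ⟨s, hs⟩ := Algebra.FiniteType.out (R := ℤ) (A := S)
  have halg : ∀ z : K, ∃ n : ℕ, n ≠ 0 ∧ IsIntegral ℤ ((n : K) * z) := fun z => by
    have hz : IsAlgebraic ℤ z := (IsFractionRing.isAlgebraic_iff ℤ ℚ K).2 (Algebra.IsAlgebraic.isAlgebraic z)
    obtain ⟨y, hy, hi⟩ := hz.exists_integral_multiple
    refine ⟨y.natAbs, by simpa using hy, ?_⟩
    rcases Int.natAbs_eq y with h | h
    · rw [h, zsmul_eq_mul, Int.cast_natCast] at hi; exact hi
    · rw [h, zsmul_eq_mul, Int.cast_neg, Int.cast_natCast, neg_mul] at hi; simpa using hi.neg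
  choose d hd0 hd using halg
  -- `N` is a common denominator of the images of the generators, so a power of `N` makes the image
  -- of any element of `S` integral.
  let N := ∏ x ∈ s, d (f x)
  have hN : ∀ x, ∃ k : ℕ, IsIntegral ℤ ((N : K) ^ k * f x) := fun x => by
    have hx : x ∈ Algebra.adjoin ℤ (s : Set S) := hs ▸ Algebra.mem_top
    have hnat : ∀ k : ℕ, IsIntegral ℤ ((N : K) ^ k) := fun k => by
      have : IsIntegral ℤ (algebraMap ℤ K ((N : ℤ) ^ k)) := isIntegral_algebraMap
      simpa using this
    induction hx using Algebra.adjoin_induction with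
    | mem x hx =>
      refine ⟨1, ?_⟩
      have : ((N : ℕ) : K) = ((∏ y ∈ s.erase x, d (f y) : ℕ) : K) * (d (f x) : K) := by
        rw [← Nat.cast_mul, Finset.prod_erase_mul _ _ hx]
      rw [pow_one, this, mul_assoc]
      refine IsIntegral.mul ?_ (hd _)
      have : IsIntegral ℤ (algebraMap ℤ K ((∏ y ∈ s.erase x, d (f y) : ℕ) : ℤ)) :=
        isIntegral_algebraMap
      simpa using this
    | algebraMap n =>
      refine ⟨0, ?_⟩
      have : IsIntegral ℤ (algebraMap ℤ K n) := isIntegral_algebraMap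
      simpa using this
    | add x y _ _ hx hy =>
      obtain ⟨k, hk⟩ := hx
      obtain ⟨l, hl⟩ := hy
      refine ⟨k + l, ?_⟩
      have : (N : K) ^ (k + l) * f (x + y) =
          (N : K) ^ l * ((N : K) ^ k * f x) + (N : K) ^ k * ((N : K) ^ l * f y) := by
        rw [map_add]; ring
      rw [this]
      exact ((hnat l).mul hk).add ((hnat k).mul hl)
    | mul x y _ _ hx hy =>
      obtain ⟨k, hk⟩ := hx
      obtain ⟨l, hl⟩ := hy
      refine ⟨k + l, ?_⟩
      have : (N : K) ^ (k + l) * f (x * y) = ((N : K) ^ k * f x) * ((N : K) ^ l * f y) := by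
        rw [map_mul]; ring
      rw [this]
      exact hk.mul hl
  refine ⟨N, Finset.prod_ne_zero_iff.2 fun x _ => hd0 _, fun p hp hpN hu => hpN ?_⟩
  obtain ⟨u, hu⟩ := hu.exists_right_inv
  obtain ⟨k, hk⟩ := hN u
  have hfu : (p : K) * f u = 1 := by
    simpa using congrArg f hu
  have hpK : (p : K) ≠ 0 := hunK p hp.ne_zero
  -- An inverse of `p` in `S` maps to `1 / p`, so `N ^ k / p` is an integral rational number, hence
  -- an integer.
  have hq : (N : K) ^ k * f u = algebraMap ℚ K ((N : ℚ) ^ k / p) := by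
    rw [map_div₀, map_pow, map_natCast, map_natCast, eq_div_iff hpK, mul_assoc, mul_comm (f u), hfu,
      mul_one]
  rw [hq, isIntegral_algebraMap_iff (algebraMap ℚ K).injective] at hk
  obtain ⟨z, hz⟩ := IsIntegrallyClosed.isIntegral_iff.1 hk
  have hpQ : (p : ℚ) ≠ 0 := by exact_mod_cast hp.ne_zero
  have hz' : ((N ^ k : ℕ) : ℤ) = p * z := by
    have : (z : ℚ) = (N : ℚ) ^ k / p := by simpa using hz
    rw [eq_div_iff hpQ] at this
    have h2 : ((N : ℚ) ^ k) = p * z := by rw [← this]; ring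
    exact_mod_cast h2
  exact hp.dvd_of_dvd_pow (Int.natCast_dvd_natCast.1 ⟨z, hz'⟩)

/-- A finitely generated commutative ring of characteristic zero has only finitely many invertible
primes. -/
theorem exists_forall_not_dvd_not_isUnit (S : Type*) [CommRing S] [Algebra ℤ S]
    [Algebra.FiniteType ℤ S] (hS : ∀ n : ℕ, n ≠ 0 → (n : S) ≠ 0) :
    ∃ N : ℕ, N ≠ 0 ∧ ∀ p : ℕ, p.Prime → ¬ p ∣ N → ¬ IsUnit (p : S) := by
  obtain ⟨K, _, _, f, _⟩ := exists_ringHom_numberField S hS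
  exact exists_forall_not_dvd_not_isUnit_of_ringHom f

/-! ### Conjugacy of an element to its powers in an abelian normal subgroup -/

open scoped IsMulCommutative in
/-- The conjugation action of `X` on a normal subgroup, with values in the endomorphisms of its
additive copy. -/
def conjAddEnd {X : Type*} [Group X] (W : Subgroup X) [W.Normal] [IsMulCommutative W] :
    X →* AddMonoid.End (Additive W) where
  toFun x := MonoidHom.toAdditive (MulAut.conjNormal x : MulAut W).toMonoidHom
  map_one' := by rw [map_one]; rfl
  map_mul' x y := by rw [map_mul]; rfl

open scoped IsMulCommutative in
theorem conjAddEnd_apply {X : Type*} [Group X] (W : Subgroup X) [W.Normal] [IsMulCommutative W]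
    (x : X) (w : W) :
    conjAddEnd W x (Additive.ofMul w) = Additive.ofMul (MulAut.conjNormal x w) := rfl

open scoped IsMulCommutative in
/-- Let `W` be an abelian normal subgroup of a finitely generated group that is centralized by the
commutator subgroup. An element of infinite order of `W` is, for all but finitely many primes `p`,
not conjugate to its `p ^ k`-th powers, `k ≠ 0`. -/
theorem exists_forall_not_isConj_pow {X : Type*} [Group X] [Group.FG X] (W : Subgroup X) [W.Normal]
    [IsMulCommutative W] (hW : commutator X ≤ Subgroup.centralizer (W : Set X)) {y : X}
    (hy : y ∈ W) (hfin : ¬ IsOfFinOrder y) :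
    ∃ N : ℕ, N ≠ 0 ∧ ∀ p : ℕ, p.Prime → ¬ p ∣ N → ∀ k : ℕ, k ≠ 0 → ¬ IsConj y (y ^ p ^ k) := by
  have hker : commutator X ≤ (conjAddEnd W).ker := fun x hx => by
    refine MonoidHom.mem_ker.2 (AddMonoidHom.ext fun w => ?_)
    refine congrArg Additive.ofMul (Subtype.ext ?_ : MulAut.conjNormal x w.toMul = w.toMul)
    rw [MulAut.conjNormal_apply, ← hW hx _ w.toMul.2, mul_inv_cancel_right]
  -- Commutators act trivially on `W`, so the action factors through the abelianization and the
  -- acting ring is commutative.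
  let ρ : Abelianization X →* AddMonoid.End (Additive W) :=
    QuotientGroup.lift (commutator X) (conjAddEnd W) hker
  let Λ : MonoidAlgebra ℤ (Abelianization X) →ₐ[ℤ] AddMonoid.End (Additive W) :=
    MonoidAlgebra.lift ℤ _ _ ρ
  let w : Additive W := Additive.ofMul ⟨y, hy⟩
  -- The annihilator of `y`, written additively as `w`.
  let I : Ideal (MonoidAlgebra ℤ (Abelianization X)) :=
    { carrier := {a | Λ a w = 0}
      zero_mem' := by simp
      add_mem' := fun {a b} ha hb => by
        have ha' : Λ a w = 0 := ha
        have hb' : Λ b w = 0 := hb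
        change Λ (a + b) w = 0
        rw [map_add]
        exact (congrArg₂ (· + ·) ha' hb').trans (add_zero 0)
      smul_mem' := fun c a ha => by
        have ha' : Λ a w = 0 := ha
        simp [ha'] }
  have hI : ∀ a, a ∈ I ↔ Λ a w = 0 := fun a => Iff.rfl
  have : Monoid.FG (Abelianization X) :=
    Monoid.fg_of_surjective (Abelianization.of (G := X)) (QuotientGroup.mk_surjective)
  have : Algebra.FiniteType ℤ (MonoidAlgebra ℤ (Abelianization X)) := inferInstance
  have hft : Algebra.FiniteType ℤ (MonoidAlgebra ℤ (Abelianization X) ⧸ I) := inferInstance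
  obtain ⟨N, hN0, hN⟩ := exists_forall_not_dvd_not_isUnit
    (MonoidAlgebra ℤ (Abelianization X) ⧸ I) fun n hn h0 => by
      rw [← map_natCast (Ideal.Quotient.mk I), Ideal.Quotient.eq_zero_iff_mem, hI, map_natCast] at h0
      refine hfin (isOfFinOrder_iff_pow_eq_one.2 ⟨n, Nat.pos_of_ne_zero hn, ?_⟩)
      have h1 : n • w = 0 := by simpa using h0
      exact congrArg (fun v : Additive W => ((v.toMul : W) : X)) h1
  refine ⟨N, hN0, fun p hp hpN k hk hconj => hN p hp hpN ?_⟩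
  obtain ⟨x, hx⟩ := isConj_iff.1 hconj
  let u : MonoidAlgebra ℤ (Abelianization X) := MonoidAlgebra.of ℤ _ (Abelianization.of x)
  have hu : IsUnit u := (Group.isUnit (Abelianization.of x)).map (MonoidAlgebra.of ℤ _)
  have huw : Λ u w = (p ^ k) • w := by
    have h1 : Λ u = conjAddEnd W x := by
      simp only [Λ, u, MonoidAlgebra.lift_of]
      rfl
    rw [h1, conjAddEnd_apply]
    refine congrArg Additive.ofMul (Subtype.ext ?_ : MulAut.conjNormal x (⟨y, hy⟩ : W) =
      (⟨y, hy⟩ : W) ^ (p ^ k))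
    rw [MulAut.conjNormal_apply, hx, SubmonoidClass.coe_pow]
  -- The unit `u` acts on `w` as `p ^ k`, so the two agree modulo the annihilator.
  have heq : Ideal.Quotient.mk I u = (p : MonoidAlgebra ℤ (Abelianization X) ⧸ I) ^ k := by
    rw [← map_natCast (Ideal.Quotient.mk I), ← map_pow, Ideal.Quotient.eq, hI, map_sub]
    refine sub_eq_zero.2 (huw.trans ?_)
    rw [← Nat.cast_pow, map_natCast]
    exact (AddMonoid.End.natCast_apply _ _).symm
  exact (isUnit_pow_iff hk).1 (heq ▸ hu.map (Ideal.Quotient.mk I))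

/-! ### Structure of the Sidki double -/

namespace SidkiDouble

variable {G : Type*} [Group G]

theorem left_mul_right_comm (g : G) : left G g * right G g = right G g * left G g := by
  have h : (QuotientGroup.mk' (Subgroup.normalClosure (sidkiRelators G)))
      ((Monoid.Coprod.inl g)⁻¹ * (Monoid.Coprod.inr g)⁻¹ * Monoid.Coprod.inl g *
        Monoid.Coprod.inr g) = 1 :=
    (QuotientGroup.eq_one_iff _).2 (Subgroup.subset_normalClosure ⟨g, rfl⟩)
  simp only [map_mul, map_inv] at h
  change (left G g)⁻¹ * (right G g)⁻¹ * left G g * right G g = 1 at h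
  rw [mul_assoc, ← mul_inv_rev, inv_mul_eq_one] at h
  exact h.symm

theorem hom_ext {K : Type*} [Group K] {f f' : SidkiDouble G →* K}
    (h₁ : ∀ g, f (left G g) = f' (left G g)) (h₂ : ∀ g, f (right G g) = f' (right G g)) :
    f = f' :=
  QuotientGroup.monoidHom_ext _ (Monoid.Coprod.hom_ext (MonoidHom.ext h₁) (MonoidHom.ext h₂))

theorem range_left_sup_range_right : (left G).range ⊔ (right G).range = ⊤ := by
  rw [left, right, MonoidHom.range_comp, MonoidHom.range_comp, ← Subgroup.map_sup,
    Monoid.Coprod.range_inl_sup_range_inr, ← MonoidHom.range_eq_map]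
  exact MonoidHom.range_eq_top.2 (QuotientGroup.mk'_surjective _)

theorem le_of_left_mem_of_right_mem {K : Subgroup (SidkiDouble G)} (h₁ : ∀ g, left G g ∈ K)
    (h₂ : ∀ g, right G g ∈ K) (x : SidkiDouble G) : x ∈ K := by
  have : (left G).range ⊔ (right G).range ≤ K :=
    sup_le (by rintro _ ⟨g, rfl⟩; exact h₁ g) (by rintro _ ⟨g, rfl⟩; exact h₂ g)
  exact this (range_left_sup_range_right (G := G) ▸ Subgroup.mem_top x)

theorem fg [Group.FG G] : Group.FG (SidkiDouble G) := by
  have h : ∀ f : G →* SidkiDouble G, f.range.FG := fun f => by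
    rw [MonoidHom.range_eq_map]
    exact (Subgroup.fg_iff_submonoid_fg _).2 (Submonoid.FG.map
      ((Subgroup.fg_iff_submonoid_fg _).1 Group.FG.out) f)
  exact ⟨range_left_sup_range_right (G := G) ▸ (h _).sup (h _)⟩

/-- The commutator `[g, h^ψ]`. -/
def crossComm (g h : G) : SidkiDouble G :=
  (left G g)⁻¹ * (right G h)⁻¹ * left G g * right G h

/-- The decoration `ψ` may be moved to the other entry of the commutator. This comes from the
relation for the product `g * h`, combined with those for `g` and `h`. -/
theorem crossComm_eq (g h : G) :
    crossComm g h = (right G g)⁻¹ * (left G h)⁻¹ * right G g * left G h := by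
  have key : ∀ g h : G, (right G g)⁻¹ * left G h * right G g * (left G h)⁻¹ =
      (left G g)⁻¹ * right G h * left G g * (right G h)⁻¹ := by
    intro g h
    have hg := left_mul_right_comm g
    have hh := left_mul_right_comm h
    have hgh := left_mul_right_comm (g * h)
    simp only [map_mul] at hgh
    generalize left G g = a at *
    generalize right G g = a' at *
    generalize left G h = b at *
    generalize right G h = b' at *
    -- The relation that `g * h` commutes with its copy.
    have e1 : b * a' * b' = a⁻¹ * a' * b' * a * b := by
      rw [eq_comm, mul_assoc, mul_assoc, mul_assoc, inv_mul_eq_iff_eq_mul]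
      simp only [mul_assoc] at hgh ⊢
      exact hgh.symm
    have e2 : a⁻¹ * a' = a' * a⁻¹ := by
      rw [inv_mul_eq_iff_eq_mul, ← mul_assoc, hg, mul_inv_cancel_right]
    have e3 : b⁻¹ * b' = b' * b⁻¹ := by
      rw [inv_mul_eq_iff_eq_mul, ← mul_assoc, hh, mul_inv_cancel_right]
    calc a'⁻¹ * b * a' * b⁻¹ = a'⁻¹ * (b * a' * (b⁻¹ * b')) * b'⁻¹ := by group
      _ = a'⁻¹ * (b * a' * b' * b⁻¹) * b'⁻¹ := by rw [e3]; group
      _ = a'⁻¹ * (a⁻¹ * a') * b' * a * b'⁻¹ := by rw [e1]; group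
      _ = a⁻¹ * b' * a * b'⁻¹ := by rw [e2]; group
  -- `key` has the inverses on the second entry misplaced; replacing `h` by its inverse corrects
  -- this.
  have := key g h⁻¹
  simpa [crossComm] using this.symm

theorem conj_left_crossComm (g h k : G) :
    (left G k)⁻¹ * crossComm g h * left G k = crossComm (g * k) h * (crossComm k h)⁻¹ := by
  simp only [crossComm, map_mul]
  group

theorem conj_right_crossComm (g h k : G) :
    (right G k)⁻¹ * crossComm g h * right G k = (crossComm g k)⁻¹ * crossComm g (h * k) := by
  simp only [crossComm, map_mul]
  group

/-- Conjugation by `k` and by `k^ψ` agree on the commutators `[g, h^ψ]`. -/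
theorem conj_left_eq_conj_right (g h k : G) :
    (left G k)⁻¹ * crossComm g h * left G k = (right G k)⁻¹ * crossComm g h * right G k := by
  -- Once `ψ` sits on the first entry, the expansion for conjugation by `k^ψ` becomes the commutator
  -- identity for conjugation by `k`.
  rw [conj_right_crossComm, crossComm_eq g h, crossComm_eq g k, crossComm_eq g (h * k)]
  simp only [map_mul]
  group

/-- The subgroup `D(G) = [G, G^ψ]`. -/
def D (G : Type*) [Group G] : Subgroup (SidkiDouble G) :=
  Subgroup.closure (Set.range fun x : G × G => crossComm x.1 x.2)

theorem crossComm_mem_D (g h : G) : crossComm g h ∈ D G := Subgroup.subset_closure ⟨(g, h), rfl⟩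

instance : (D G).Normal := by
  have aux : ∀ z : SidkiDouble G, (∀ g h, z⁻¹ * crossComm g h * z ∈ D G) →
      ∀ d ∈ D G, z⁻¹ * d * z ∈ D G := by
    intro z hz d hd
    have : D G ≤ (D G).comap (MulAut.conj z⁻¹).toMonoidHom := by
      refine (Subgroup.closure_le _).2 ?_
      rintro _ ⟨x, rfl⟩
      simpa using hz x.1 x.2
    simpa using this hd
  have hl : ∀ k : G, ∀ d ∈ D G, (left G k)⁻¹ * d * left G k ∈ D G := fun k => aux _ fun g h => by
    rw [conj_left_crossComm]
    exact mul_mem (crossComm_mem_D _ _) (inv_mem (crossComm_mem_D _ _))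
  have hr : ∀ k : G, ∀ d ∈ D G, (right G k)⁻¹ * d * right G k ∈ D G := fun k => aux _ fun g h => by
    rw [conj_right_crossComm]
    exact mul_mem (inv_mem (crossComm_mem_D _ _)) (crossComm_mem_D _ _)
  have mem : ∀ f : G →* SidkiDouble G, (∀ k : G, ∀ d ∈ D G, (f k)⁻¹ * d * f k ∈ D G) →
      ∀ k, f k ∈ Subgroup.normalizer (D G : Set (SidkiDouble G)) := by
    intro f hf k
    rw [Subgroup.mem_normalizer_iff]
    intro d
    constructor
    · intro hd
      simpa using hf k⁻¹ d hd
    · intro hd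
      simpa [mul_assoc] using hf k _ hd
  rw [← Subgroup.normalizer_eq_top_iff, eq_top_iff]
  exact fun x _ => le_of_left_mem_of_right_mem (mem _ hl) (mem _ hr) x

/-- The subgroup `L(G)`, the normal closure of the elements `g⁻¹ g^ψ`. -/
def L (G : Type*) [Group G] : Subgroup (SidkiDouble G) :=
  Subgroup.normalClosure (Set.range fun g : G => (left G g)⁻¹ * right G g)

instance : (L G).Normal := Subgroup.normalClosure_normal

/-- Conjugation by `k` and by `k^ψ` agree on the generators of `D G`, so the quotient of `k^ψ` by
`k` centralizes them; the centralizer of the normal subgroup `D G` is normal. -/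
theorem L_le_centralizer_D : L G ≤ Subgroup.centralizer (D G : Set (SidkiDouble G)) := by
  refine Subgroup.normalClosure_le_normal ?_
  rintro _ ⟨k, rfl⟩
  have hD : D G ≤ Subgroup.centralizer {(left G k)⁻¹ * right G k} := by
    refine (Subgroup.closure_le _).2 ?_
    rintro _ ⟨⟨g, h⟩, rfl⟩
    rw [SetLike.mem_coe, Subgroup.mem_centralizer_singleton_iff]
    have h1 := conj_left_eq_conj_right g h k
    have h2 := left_mul_right_comm k
    dsimp only
    generalize crossComm g h = c at *
    generalize left G k = a at *
    generalize right G k = b at *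
    have h3 : a⁻¹ * b = b * a⁻¹ := by
      rw [inv_mul_eq_iff_eq_mul, ← mul_assoc, h2, mul_inv_cancel_right]
    calc c * (a⁻¹ * b) = b * (b⁻¹ * c * b) * a⁻¹ := by rw [h3]; group
      _ = b * (a⁻¹ * c * a) * a⁻¹ := by rw [h1]
      _ = (b * a⁻¹) * c := by group
      _ = a⁻¹ * b * c := by rw [h3]
  exact Subgroup.mem_centralizer_iff.2 fun d hd =>
    Subgroup.mem_centralizer_singleton_iff.1 (hD hd)

theorem commute_mk_of_D_le {K : Subgroup (SidkiDouble G)} [K.Normal] (hK : D G ≤ K) (g h : G) :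
    Commute (QuotientGroup.mk' K (left G g)) (QuotientGroup.mk' K (right G h)) := by
  have : QuotientGroup.mk' K (crossComm g h) = 1 :=
    (QuotientGroup.eq_one_iff _).2 (hK (crossComm_mem_D g h))
  simp only [crossComm, map_mul, map_inv] at this
  rw [mul_assoc, ← mul_inv_rev, inv_mul_eq_one] at this
  exact this.symm

/-- Modulo `D G` the two copies of `G` commute, so the quotient map factors through the outer two
coordinates of `rho`. -/
theorem W_le_D : W G ≤ D G := by
  let π := QuotientGroup.mk' (D G)
  have hcomm := commute_mk_of_D_le (le_refl (D G))
  let φ : G × G →* SidkiDouble G ⧸ D G :=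
    MonoidHom.noncommCoprod (π.comp (left G)) (π.comp (right G)) hcomm
  have hφ : φ.comp (((MonoidHom.fst G (G × G)).prod
      ((MonoidHom.snd G G).comp (MonoidHom.snd G (G × G)))).comp (rho G)) = π :=
    hom_ext (fun g => by simp [φ, rho_left]) (fun g => by simp [φ, rho_right])
  intro w hw
  have h1 : rho G w = 1 := hw
  refine (QuotientGroup.eq_one_iff w).1 ?_
  change π w = 1
  rw [← hφ, MonoidHom.comp_apply, MonoidHom.comp_apply, h1, map_one, map_one]

/-- Modulo `L G` the two copies of `G` are identified, so only the middle coordinate of `rho`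
matters. -/
theorem mk_eq_mk_left_of_L_le {K : Subgroup (SidkiDouble G)} [K.Normal] (hK : L G ≤ K)
    (x : SidkiDouble G) :
    QuotientGroup.mk' K x = QuotientGroup.mk' K (left G (rho G x).2.1) := by
  have hK' : ∀ g : G, QuotientGroup.mk' K (left G g) = QuotientGroup.mk' K (right G g) := fun g =>
    QuotientGroup.eq.2 (hK (Subgroup.subset_normalClosure ⟨g, rfl⟩))
  have h : ((QuotientGroup.mk' K).comp (left G)).comp
      (((MonoidHom.fst G G).comp (MonoidHom.snd G (G × G))).comp (rho G)) = QuotientGroup.mk' K :=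
    hom_ext (fun g => by simp [rho_left]) (fun g => by simpa [rho_right] using hK' g)
  exact (DFunLike.congr_fun h x).symm

theorem W_le_L : W G ≤ L G := by
  intro w hw
  have h1 : rho G w = 1 := hw
  refine (QuotientGroup.eq_one_iff w).1 ?_
  have := mk_eq_mk_left_of_L_le le_rfl w
  rwa [h1, Prod.snd_one, Prod.fst_one, map_one, map_one] at this

instance : (W G).Normal := MonoidHom.normal_ker _

theorem D_le_centralizer_W : D G ≤ Subgroup.centralizer (W G : Set (SidkiDouble G)) := 
  Subgroup.le_centralizer_iff.1 (W_le_L.trans L_le_centralizer_D)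

theorem L_le_centralizer_W : L G ≤ Subgroup.centralizer (W G : Set (SidkiDouble G)) := 
  L_le_centralizer_D.trans (Subgroup.centralizer_le W_le_D)

theorem W_mul_comm {v w : SidkiDouble G} (hv : v ∈ W G) (hw : w ∈ W G) : v * w = w * v :=
  (D_le_centralizer_W (W_le_D hw) v hv)

/-- The centralizer of `W G` contains both `D G` and `L G`. Modulo it the two copies of `G` commute
and coincide, so the quotient is abelian. -/
theorem commutator_le_centralizer_W :
    commutator (SidkiDouble G) ≤ Subgroup.centralizer (W G : Set (SidkiDouble G)) := by
  set C := Subgroup.centralizer (W G : Set (SidkiDouble G)) with hC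
  have : C.Normal := Subgroup.normal_centralizer
  have hcomm : ∀ g h : G, Commute (QuotientGroup.mk' C (left G g))
      (QuotientGroup.mk' C (right G h)) :=
    commute_mk_of_D_le D_le_centralizer_W
  rw [commutator_eq_closure, Subgroup.closure_le]
  rintro _ ⟨x, y, rfl⟩
  refine (QuotientGroup.eq_one_iff (N := C) _).1 ?_
  change QuotientGroup.mk' C (x * y * x⁻¹ * y⁻¹) = 1
  rw [map_mul, map_mul, map_mul, map_inv, map_inv, mul_inv_eq_one, mul_inv_eq_iff_eq_mul,
    mk_eq_mk_left_of_L_le L_le_centralizer_W x, mk_eq_mk_left_of_L_le L_le_centralizer_W y]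
  -- This represents `y` by an element of the second copy, which commutes with the representative of
  -- `x` in the first.
  have h := mk_eq_mk_left_of_L_le L_le_centralizer_W (right G (rho G y).2.1)
  rw [rho_right] at h
  rw [← h]
  exact (hcomm _ _).eq

end SidkiDouble

/-! ### Reduction from `ℂ` to characteristic `p`, and the conclusion -/

/-- The coefficients of a matrix over a group ring over a field lie in a finitely generated
subring, which may be taken to contain a prescribed element and its inverse. -/
theorem exists_descent {H : Type*} [Group H] {n : ℕ}
    (A : Matrix (Fin n) (Fin n) (MonoidAlgebra ℂ H)) (z : ℂ) :
    ∃ S : Subalgebra ℤ ℂ, Algebra.FiniteType ℤ S ∧ z ∈ S ∧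
      ∃ B : Matrix (Fin n) (Fin n) (MonoidAlgebra S H),
        B.map (MonoidAlgebra.mapRingHom H S.val.toRingHom) = A := by
  classical
  let s : Finset ℂ := insert z
    (Finset.univ.biUnion fun i => Finset.univ.biUnion fun j =>
      (A i j).coeff.support.image (A i j).coeff)
  let S : Subalgebra ℤ ℂ := Algebra.adjoin ℤ (s : Set ℂ)
  have hs : ∀ x ∈ s, x ∈ S := fun x hx => Algebra.subset_adjoin hx
  have hmem : ∀ i j h, (A i j).coeff h ∈ S := fun i j h => by
    by_cases h0 : (A i j).coeff h = 0
    · rw [h0]; exact zero_mem S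
    · refine hs _ (Finset.mem_insert_of_mem ?_)
      simp only [Finset.mem_biUnion, Finset.mem_univ, true_and, Finset.mem_image]
      exact ⟨i, j, h, Finsupp.mem_support_iff.2 h0, rfl⟩
  have hlift : ∀ i j, ∃ b : MonoidAlgebra S H,
      MonoidAlgebra.mapRingHom H S.val.toRingHom b = A i j := fun i j => by
    have : A i j ∈ Set.range (MonoidAlgebra.map (M := H) (S.val.toRingHom : S →+ ℂ)) := by
      rw [MonoidAlgebra.range_map]
      exact fun h => ⟨⟨_, hmem i j h⟩, rfl⟩
    exact this
  choose B hB using hlift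
  refine ⟨S, ?_, hs z (Finset.mem_insert_self _ _), B, ?_⟩
  · exact (Subalgebra.fg_iff_finiteType _).1 (Subalgebra.fg_adjoin_finset s)
  · ext1 i j
    exact hB i j

/-- If the trace of an idempotent matrix over `ℂ H` does not vanish at `x`, then for all but
finitely many primes `p` the element `x` is conjugate to `x ^ p ^ k` for some `k ≠ 0`. -/
theorem exists_isConj_pow_of_hattoriStallingsTrace_ne_zero {H : Type*} [Group H] {n : ℕ}
    {A : Matrix (Fin n) (Fin n) (MonoidAlgebra ℂ H)} (hA : IsIdempotentElem A) {x : H}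
    (hx : hattoriStallingsTrace A x ≠ 0) :
    ∃ N : ℕ, N ≠ 0 ∧ ∀ p : ℕ, p.Prime → ¬ p ∣ N → ∃ k : ℕ, k ≠ 0 ∧ IsConj x (x ^ p ^ k) := by
  -- With its inverse in `S`, the trace at `x` is a unit of `S` and stays nonzero modulo every
  -- maximal ideal.
  obtain ⟨S, hS, hz, B, hB⟩ := exists_descent A (hattoriStallingsTrace A x)⁻¹
  have hinj : Function.Injective (MonoidAlgebra.mapRingHom H S.val.toRingHom) :=
    MonoidAlgebra.map_injective _ Subtype.val_injective
  have hBi : IsIdempotentElem B := by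
    refine Matrix.map_injective hinj ?_
    change (B * B).map _ = _
    rw [Matrix.map_mul, hB]
    exact hA.trans hB.symm
  obtain ⟨N, hN0, hN⟩ := exists_forall_not_dvd_not_isUnit S fun n hn h0 => by
    have : ((n : S) : ℂ) = 0 := by rw [h0]; rfl
    exact hn (by exact_mod_cast this)
  refine ⟨N, hN0, fun p hp hpN => ?_⟩
  have : Fact p.Prime := ⟨hp⟩
  obtain ⟨P, hP, hpP⟩ := exists_max_ideal_of_mem_nonunits (hN p hp hpN)
  let f := Ideal.Quotient.mk P
  have : Nontrivial (S ⧸ P) := Ideal.Quotient.nontrivial_iff.2 hP.ne_top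
  have : CharP (S ⧸ P) p := (CharP.charP_iff_prime_eq_zero hp).2 (by
    rw [← map_natCast f]
    exact Ideal.Quotient.eq_zero_iff_mem.2 hpP)
  have hr : IsUnit (traceClassSum S H n B (ConjClasses.mk x)) := by
    refine IsUnit.of_mul_eq_one ⟨_, hz⟩ (Subtype.ext ?_)
    have h1 := traceClassSum_map S.val.toRingHom B (ConjClasses.mk x)
    rw [hB, ← hattoriStallingsTrace_eq] at h1
    have h2 : hattoriStallingsTrace A x = (traceClassSum S H n B (ConjClasses.mk x) : ℂ) := h1
    change (traceClassSum S H n B (ConjClasses.mk x) : ℂ) * (hattoriStallingsTrace A x)⁻¹ = 1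
    rw [← h2, mul_inv_cancel₀ hx]
  have hC : IsIdempotentElem (B.map (MonoidAlgebra.mapRingHom H f)) := by
    change B.map _ * B.map _ = B.map _
    rw [← Matrix.map_mul, hBi.eq]
  obtain ⟨k, hk, hpow⟩ := exists_powMap_pow_eq_of_isIdempotentElem (p := p) hC
    (c := ConjClasses.mk x) (by
      rw [Finsupp.mem_support_iff, traceClassSum_map]
      exact (hr.map f).ne_zero)
  exact ⟨k, hk, (ConjClasses.mk_eq_mk_iff_isConj.1 hpow).symm⟩

theorem hattoriStallingsTrace_eq_zero_of_mem_W {G : Type*} [Group G] (hG : Group.FG G) {n : ℕ}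
    {A : Matrix (Fin n) (Fin n) (MonoidAlgebra ℂ (SidkiDouble G))} (hA : IsIdempotentElem A)
    {y : SidkiDouble G} (hy : y ∈ SidkiDouble.W G) (hfin : ¬ IsOfFinOrder y) :
    hattoriStallingsTrace A y = 0 := by
  by_contra hne
  have : Group.FG (SidkiDouble G) := SidkiDouble.fg
  have : IsMulCommutative (SidkiDouble.W G) :=
    ⟨⟨fun v w => Subtype.ext (SidkiDouble.W_mul_comm v.2 w.2)⟩⟩
  obtain ⟨N, hN0, hN⟩ := exists_forall_not_isConj_pow (SidkiDouble.W G)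
    SidkiDouble.commutator_le_centralizer_W hy hfin
  obtain ⟨M, hM0, hM⟩ := exists_isConj_pow_of_hattoriStallingsTrace_ne_zero hA hne
  -- A prime larger than `N * M` divides neither factor, so both facts apply to it.
  obtain ⟨p, hp1, hp⟩ := Nat.exists_infinite_primes (N * M + 1)
  have hndvd : ∀ m : ℕ, m ∣ N * M → m ≠ 0 → ¬ p ∣ m := fun m hm hm0 h => by
    have h1 := Nat.le_of_dvd (Nat.pos_of_ne_zero (mul_ne_zero hN0 hM0)) (h.trans hm)
    omega
  obtain ⟨k, hk, hconj⟩ := hM p hp (hndvd M (dvd_mul_left _ _) hM0)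
  exact hN p hp (hndvd N (dvd_mul_right _ _) hN0) k hk hconj

theorem mainTheorem3 {G : Type*} [Group G] (hG : Group.FG G) :
    (∀ (n : ℕ) (A : Matrix (Fin n) (Fin n) (MonoidAlgebra ℤ (SidkiDouble G))),
        IsIdempotentElem A → ∀ y ∈ SidkiDouble.W G, ¬ IsOfFinOrder y →
          hattoriStallingsTrace A y = 0) ∧
    (∀ (n : ℕ) (A : Matrix (Fin n) (Fin n) (MonoidAlgebra ℂ (SidkiDouble G))),
        IsIdempotentElem A → ∀ y ∈ SidkiDouble.W G, ¬ IsOfFinOrder y →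
          hattoriStallingsTrace A y = 0) := by
  refine ⟨fun n A hA y hy hfin => ?_, fun n A hA y hy hfin =>
    hattoriStallingsTrace_eq_zero_of_mem_W hG hA hy hfin⟩
  have hC : IsIdempotentElem
      (A.map (MonoidAlgebra.mapRingHom (SidkiDouble G) (Int.castRingHom ℂ))) := by
    change A.map _ * A.map _ = A.map _
    rw [← Matrix.map_mul, hA.eq]
  have h := hattoriStallingsTrace_eq_zero_of_mem_W hG hC hy hfin
  rw [hattoriStallingsTrace_eq, traceClassSum_map] at h
  rw [hattoriStallingsTrace_eq]
  exact Int.cast_eq_zero.1 h
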